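/- Let $K$ be a field and $\mathcal R=K[t^{-1},t]]$ the field of Laurent series in $t$. **Framed graphs and ideals.** Let $G$ be a framed graph: an oriented graph, properly embedded in the disk, with thin edges, thick edges (each with two incoming and two outgoing thin edges), bivalent vertices (one incoming and one outgoing thin edge) and univalent boundary vertices, in which every connected component has a vertex of degree greater than one, and in which each thin edge $e$ carries an integer framing $\ell_e$. Label the first and second segments of each thin edge $e$ (with respect to the orientation) by variables $x_e$ and $y_e$. The edge ring is $\mathcal E(G)=\mathcal R[x_e : e \text{ thin}]$, which is the quotient of $\mathcal R[x_e,y_e : e\text{ thin}]$ by the framing ideal generated by all $t^{\ell_e}y_e-x_e$. The following ideals are taken in $\mathcal E(G)$, that is, $y_e$ stands for $t^{-\ell_e}x_e$. * The quadratic (local) ideal $Q(G)$ is generated by $x_ax_b-y_cy_d$ for each thick edge with outgoing thin edges $a,b$ and incoming thin edges $c,d$, and by $x_a-y_c$ for each bivalent vertex with outgoing edge $a$ and incoming edge $c$. * The non-local ideal $N(G)$ is generated by $t^{w(\Gamma)}x_{\Gamma,\mathrm{out}}-y_{\Gamma,\mathrm{in}}$ for all sets $\Gamma$ of thick edges and bivalent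 vertices. Here $w(\Gamma)$ is the sum of the framings of the thin edges that both start and end in $\Gamma$, $x_{\Gamma,\mathrm{out}}$ is the product of the $x_e$ over the thin edges $e$ that start in $\Gamma$ and do not end in $\Gamma$, and $y_{\Gamma,\mathrm{in}}$ is the product of the $y_e$ over the thin edges $e$ that end in $\Gamma$ and do not start in $\Gamma$. **Braid graphs and closures.** Let $b\ge 1$, and let $G_\sigma$ be an arbitrarily framed braid graph on $b$ strands, none of them closed: it is obtained from a braid diagram, oriented upwards, by replacing crossings with thick edges, where bivalent vertices may also be placed on the strands, and every strand carries at least one thick edge or bivalent vertex. Number the strand positions $1,\dots,b$ from right to left. For $0\le k\le b-1$ let $G_\sigma^{(k)}$ be the framed graph obtained from $G_\sigma$ by closing the $k$ right-most strands, where closing a strand merges its top and bottom boundary edges into one edge, whose framing is the sum of their framings. Write $G_{\hat\sigma}=G_\sigma^{(b-1)}$. Let $z_\tau^{(k)}$ and $z_\beta^{(k)}$ be the variables $x_e$ of the top and bottom boundary edges of the $k$-th strand, and let $a_k$ be the framing of the top boundary edge of the $k$-th strand of $G_\sigma$. For $0\le k\le b-2$ let $\pi_k:\mathcal E(G_\sigma^{(k)})\to\mathcal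 E(G_\sigma^{(k+1)})$ be the quotient map with kernel generated by $z_\tau^{(k+1)}-t^{a_{k+1}}z_\beta^{(k+1)}$ that retains $z_\tau^{(k+1)}$ (now the variable of the closure edge) and discards $z_\beta^{(k+1)}$; thus $\pi_k(z_\beta^{(k+1)})=t^{-a_{k+1}}z_\tau^{(k+1)}$, and all other variables are fixed. Put $\pi=\pi_{b-2}\circ\cdots\circ\pi_0$ and $z_\tau=z_\tau^{(1)}\cdots z_\tau^{(b-1)}$ (for $b=1$, $\pi$ is the identity and $z_\tau=1$). **Corollary 1.2.** In $\mathcal E(G_{\hat\sigma})$, $$\pi(Q(G_\sigma)):(z_\tau)=N(G_{\hat\sigma}),$$ where $I:J=\{r : rJ\subseteq I\}$ denotes the ideal quotient. -/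

import Mathlib

open MvPolynomial

noncomputable section

/-! ### Framed graphs and their ideals -/

/-- The combinatorial data of a framed graph that enter the definitions of its ideals.
`Node` is the set of thick edges and bivalent vertices, `Edge` the set of thin edges.
A thin edge starts at `src e` and ends at `tgt e`; the value `none` stands for a boundary
(univalent) vertex.  `framing e` is the integer marking of the thin edge `e`
(thick edges are blackboard framed). -/
structure FramedGraph (Node Edge : Type) where
  src : Edge → Option Node
  tgt : Edge → Option Node
  framing : Edge → ℤ

/-- A substitution of variables is the quotient map by an ideal `I`, as soon as it has a section `s`,
its kernel contains `I`, and it changes every variable only modulo `I`. -/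
theorem MvPolynomial.ker_eq_of_section {R σ τ : Type*} [CommRing R]
    (φ : MvPolynomial σ R →ₐ[R] MvPolynomial τ R) (s : MvPolynomial τ R →ₐ[R] MvPolynomial σ R)
    (I : Ideal (MvPolynomial σ R)) (hI : I ≤ RingHom.ker φ)
    (hs : ∀ i, X i - s (φ (X i)) ∈ I) : RingHom.ker φ = I := by
  refine le_antisymm (fun p hp => ?_) hI
  have key : (Ideal.Quotient.mkₐ R I) = ((Ideal.Quotient.mkₐ R I).comp s).comp φ := by
    refine MvPolynomial.algHom_ext fun i => ?_
    exact Ideal.Quotient.eq.mpr (hs i)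
  have h := DFunLike.congr_fun key p
  rw [RingHom.mem_ker] at hp
  simp only [AlgHom.comp_apply] at h
  rw [hp, map_zero, map_zero] at h
  exact Ideal.Quotient.eq_zero_iff_mem.mp h

namespace FramedGraph

/-- The power `t ^ n` (`n` an integer) in the field of Laurent series in `t` over `K`. -/
abbrev tpow (K : Type*) [Field K] (n : ℤ) : LaurentSeries K := HahnSeries.single n 1

/-- The polynomial ring on the variables `x_e` and `y_e`, for all thin edges `e`. -/
abbrev FullRing (K : Type*) [Field K] (Edge : Type) : Type _ := MvPolynomial (Edge ⊕ Edge) (LaurentSeries K)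

variable (K : Type*) [Field K] {Node Edge : Type} (G : FramedGraph Node Edge)

/-- The label `x_e` of the first segment of the thin edge `e`. -/
def x (e : Edge) : FullRing K Edge := X (Sum.inl e)

/-- The label `y_e` of the second segment of the thin edge `e`. -/
def y (e : Edge) : FullRing K Edge := X (Sum.inr e)

/-- The framing ideal, generated by `t ^ ℓ y_e - x_e`, with `ℓ` the framing of `e`. -/
def framingIdeal : Ideal (FullRing K Edge) :=
  Ideal.span (Set.range fun e => C (tpow K (G.framing e)) * y K e - x K e)

/-- The edge ring, the polynomial ring on the variables `x_e` for all thin edges `e`. -/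
abbrev EdgeRing (K : Type*) [Field K] (Edge : Type) : Type _ := MvPolynomial Edge (LaurentSeries K)

/-- The projection to the edge ring that retains the `x_e`
and eliminates the `y_e` by means of the framing ideal. -/
def toEdgeRing : FullRing K Edge →ₐ[LaurentSeries K] EdgeRing K Edge :=
  aeval (Sum.elim (fun e => X e) (fun e => C (tpow K (-G.framing e)) * X e))

/-- The edge ring is the quotient of the polynomial ring on all `x_e`, `y_e` by the framing ideal. -/
theorem ker_toEdgeRing : RingHom.ker (G.toEdgeRing K) = G.framingIdeal K := by
  have hmul (n : ℤ) : tpow K n * tpow K (-n) = 1 := by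
    simp [tpow, HahnSeries.single_mul_single]
  refine MvPolynomial.ker_eq_of_section _ (aeval fun e => X (Sum.inl e)) _ ?_ ?_
  · rw [framingIdeal, Ideal.span_le]
    rintro _ ⟨e, rfl⟩
    simp only [SetLike.mem_coe, RingHom.mem_ker, toEdgeRing, x, y, map_sub, map_mul, aeval_X,
      Sum.elim_inl, Sum.elim_inr, algHom_C, algebraMap_eq]
    rw [← mul_assoc, ← C_mul, hmul, C_1, one_mul, sub_self]
  · rintro (e | e)
    · simp [toEdgeRing]
    · have h : (X (Sum.inr e) : FullRing K Edge) - C (tpow K (-G.framing e)) * X (Sum.inl e)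
          = C (tpow K (-G.framing e)) * (C (tpow K (G.framing e)) * y K e - x K e) := by
        rw [mul_sub, ← mul_assoc, ← C_mul, mul_comm (tpow K _), hmul, C_1, one_mul, x, y]
      simp only [toEdgeRing, aeval_X, Sum.elim_inr, map_mul, algHom_C, algebraMap_eq]
      rw [h]
      exact Ideal.mul_mem_left _ _ (Ideal.subset_span ⟨e, rfl⟩)

/-- The edge `e` starts at a node of `Γ`. -/
def StartsIn (Γ : Finset Node) (e : Edge) : Prop := ∃ v ∈ Γ, G.src e = some v

/-- The edge `e` ends at a node of `Γ`. -/
def EndsIn (Γ : Finset Node) (e : Edge) : Prop := ∃ v ∈ Γ, G.tgt e = some v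

instance [DecidableEq Node] (Γ : Finset Node) : DecidablePred (G.StartsIn Γ) :=
  fun e => inferInstanceAs (Decidable (∃ v ∈ Γ, G.src e = some v))

instance [DecidableEq Node] (Γ : Finset Node) : DecidablePred (G.EndsIn Γ) :=
  fun e => inferInstanceAs (Decidable (∃ v ∈ Γ, G.tgt e = some v))

/-- The generator of the quadratic ideal at a node: the product of the `x` on the outgoing thin
edges minus the product of the `y` on the incoming thin edges.  This is `x_a x_b - y_c y_d` at a
thick edge and `x_a - y_c` at a bivalent vertex. -/
def quadraticGen [DecidableEq Node] [Fintype Edge] (v : Node) : FullRing K Edge :=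
  (∏ e with G.src e = some v, x K e) - ∏ e with G.tgt e = some v, y K e

/-- The quadratic (local) ideal `Q(G)`, as an ideal of the edge ring. -/
def quadraticIdeal [DecidableEq Node] [Fintype Edge] : Ideal (EdgeRing K Edge) :=
  (Ideal.span (Set.range (G.quadraticGen K))).map (G.toEdgeRing K)

/-- The weight of a set of nodes: the sum of the framings on its internal thin edges. -/
def weight [DecidableEq Node] [Fintype Edge] (Γ : Finset Node) : ℤ :=
  ∑ e with G.StartsIn Γ e ∧ G.EndsIn Γ e, G.framing e

/-- The generator `t ^ (weight Γ) x_{Γ,out} - y_{Γ,in}` of the non-local ideal. -/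
def nonlocalGen [DecidableEq Node] [Fintype Edge] (Γ : Finset Node) : FullRing K Edge :=
  C (tpow K (G.weight Γ)) * (∏ e with G.StartsIn Γ e ∧ ¬ G.EndsIn Γ e, x K e)
    - ∏ e with G.EndsIn Γ e ∧ ¬ G.StartsIn Γ e, y K e

/-- The non-local ideal `N(G)`, as an ideal of the edge ring. -/
def nonlocalIdeal [DecidableEq Node] [Fintype Edge] : Ideal (EdgeRing K Edge) :=
  (Ideal.span (Set.range (G.nonlocalGen K))).map (G.toEdgeRing K)

end FramedGraph

/-! ### Braid graphs and their closures -/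

/-- A node of a braid graph with `b` strand positions, numbered from right to left by
`0, …, b - 1`: a thick edge joining the adjacent positions `i` and `i + 1`,
or a bivalent vertex on position `i`. -/
inductive BraidNode (b : ℕ) : Type
  | thick (i : ℕ) (hi : i + 1 < b) : BraidNode b
  | bivalent (i : Fin b) : BraidNode b

/-- The strand positions that pass through a node. -/
def BraidNode.strands {b : ℕ} : BraidNode b → Finset (Fin b)
  | .thick i hi => {⟨i, Nat.lt_of_succ_lt hi⟩, ⟨i + 1, hi⟩}
  | .bivalent i => {i}

/-- A braid graph on `b` strands, none of them closed, oriented upwards: a sequence of nodes,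
listed from bottom to top, such that each strand carries at least one node. -/
structure BraidGraph (b : ℕ) where
  size : ℕ
  node : Fin size → BraidNode b
  exists_node : ∀ i, ∃ v, i ∈ (node v).strands

namespace BraidGraph

variable {b : ℕ} (B : BraidGraph b)

/-- The nodes on the strand `i`. -/
def nodesOn (i : Fin b) : Finset (Fin B.size) := {v | i ∈ (B.node v).strands}

theorem nodesOn_nonempty (i : Fin b) : (B.nodesOn i).Nonempty := by
  obtain ⟨v, hv⟩ := B.exists_node i
  exact ⟨v, by simpa [nodesOn] using hv⟩

/-- The top-most node on the strand `i`. -/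
def topNode (i : Fin b) : Fin B.size := (B.nodesOn i).max' (B.nodesOn_nonempty i)

/-- The bottom-most node on the strand `i`. -/
def botNode (i : Fin b) : Fin B.size := (B.nodesOn i).min' (B.nodesOn_nonempty i)

theorem mem_strands_topNode (i : Fin b) : i ∈ (B.node (B.topNode i)).strands := by
  have h : B.topNode i ∈ B.nodesOn i := (B.nodesOn i).max'_mem (B.nodesOn_nonempty i)
  simpa only [nodesOn, Finset.mem_filter, Finset.mem_univ, true_and] using h

/-- The thin edges of the graph obtained by closing the `k` right-most strands, that is, the
strands `i` with `i < k`.  They are the bottom boundary edges of the strands that remain open and,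
for each node `v` and each strand `i` through `v`, the edge that leaves `v` along the strand `i`.
When a strand is closed, its bottom boundary edge is merged into its top boundary edge. -/
abbrev Edge (k : ℕ) : Type :=
  {i : Fin b // k ≤ i.val} ⊕ {p : Fin B.size × Fin b // p.2 ∈ (B.node p.1).strands}

/-- The bottom boundary edge of the strand `i`, which is not closed. -/
def botEdge {k : ℕ} (i : Fin b) (hi : k ≤ i.val) : B.Edge k := Sum.inl ⟨i, hi⟩

/-- The top-most edge of the strand `i`; it is a boundary edge if the strand is open,
and a closure edge if the strand is closed. -/
def topEdge (k : ℕ) (i : Fin b) : B.Edge k :=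
  Sum.inr ⟨(B.topNode i, i), B.mem_strands_topNode i⟩

/-- The nodes on the strand `i` above the node `v`. -/
def nodesAbove (v : Fin B.size) (i : Fin b) : Finset (Fin B.size) := {w ∈ B.nodesOn i | v < w}

/-- The framed graph obtained from the braid graph with framing `ℓ` by closing the `k` right-most
strands.  An edge that leaves the top-most node of a closed strand returns to the bottom-most node
of this strand, and its framing is the sum of those of the two boundary edges that form it. -/
def closing (ℓ : B.Edge 0 → ℤ) (k : ℕ) : FramedGraph (Fin B.size) (B.Edge k) where
  src
    | .inl _ => none
    | .inr p => some p.1.1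
  tgt
    | .inl i => some (B.botNode i.1)
    | .inr p =>
      if h : (B.nodesAbove p.1.1 p.1.2).Nonempty then some ((B.nodesAbove p.1.1 p.1.2).min' h)
      else if p.1.2.val < k then some (B.botNode p.1.2)
      else none
  framing
    | .inl i => ℓ (B.botEdge i.1 (Nat.zero_le _))
    | .inr p =>
      if p.1.1 = B.topNode p.1.2 ∧ p.1.2.val < k then
        ℓ (.inr p) + ℓ (B.botEdge p.1.2 (Nat.zero_le _))
      else ℓ (.inr p)

variable (K : Type*) [Field K] (ℓ : B.Edge 0 → ℤ)

/-- The edge ring of the graph with the `k` right-most strands closed. -/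
abbrev ClosingRing (k : ℕ) : Type _ := FramedGraph.EdgeRing K (B.Edge k)

/-- The variable of the top-most edge of the strand `i`. -/
def zTop (k : ℕ) (i : Fin b) : B.ClosingRing K k := X (B.topEdge k i)

/-- The variable of the bottom-most edge of the open strand `i`. -/
def zBot (k : ℕ) (i : Fin b) (hi : k ≤ i.val) : B.ClosingRing K k := X (B.botEdge i hi)

/-- The map of edge rings that corresponds to closing one more strand, the strand `k`.  With `a`
the framing on the top boundary edge of this strand, it eliminates the bottom variable of the
strand by means of `zTop - t ^ a * zBot`, and retains all other variables. -/
def closeStrand (k : ℕ) :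
    B.ClosingRing K k →ₐ[LaurentSeries K] B.ClosingRing K (k + 1) :=
  aeval (Sum.elim
    (fun i => if h : k + 1 ≤ i.1.val then B.zBot K (k + 1) i.1 h
      else C (FramedGraph.tpow K (-ℓ (B.topEdge 0 i.1))) * B.zTop K (k + 1) i.1)
    (fun p => X (Sum.inr p)))

/-- Closing the strand `k` is the quotient map by the ideal generated by `zTop - t ^ a * zBot`. -/
theorem ker_closeStrand (k : ℕ) (hk : k < b) :
    RingHom.ker (B.closeStrand K ℓ k) = Ideal.span {B.zTop K k ⟨k, hk⟩ -
      C (FramedGraph.tpow K (ℓ (B.topEdge 0 ⟨k, hk⟩))) * B.zBot K k ⟨k, hk⟩ le_rfl} := by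
  have hmul (n : ℤ) : FramedGraph.tpow K n * FramedGraph.tpow K (-n) = 1 := by
    simp [FramedGraph.tpow, HahnSeries.single_mul_single]
  refine MvPolynomial.ker_eq_of_section _
    (aeval (Sum.elim (fun i => X (Sum.inl ⟨i.1, (Nat.le_succ k).trans i.2⟩))
      (fun p => X (Sum.inr p)))) _ ?_ ?_
  · rw [Ideal.span_le, Set.singleton_subset_iff]
    simp only [SetLike.mem_coe, RingHom.mem_ker, closeStrand, zTop, zBot, topEdge, botEdge, map_sub,
      map_mul, aeval_X, Sum.elim_inl, Sum.elim_inr, algHom_C, algebraMap_eq]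
    rw [dif_neg (by simp), ← mul_assoc, ← C_mul, hmul, C_1, one_mul, sub_self]
  · rintro (⟨i, hi⟩ | p)
    · by_cases h : k + 1 ≤ i.val
      · simp only [closeStrand, aeval_X, Sum.elim_inl, dif_pos h, zBot, botEdge, sub_self,
          Submodule.zero_mem]
      · obtain rfl : i = ⟨k, hk⟩ := Fin.ext (by simp only; omega)
        have e (a : ℤ) : B.zBot K k ⟨k, hk⟩ le_rfl
            - C (FramedGraph.tpow K (-a)) * B.zTop K k ⟨k, hk⟩
            = -C (FramedGraph.tpow K (-a)) * (B.zTop K k ⟨k, hk⟩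
              - C (FramedGraph.tpow K a) * B.zBot K k ⟨k, hk⟩ le_rfl) := by
          have hC : (C (FramedGraph.tpow K a) * C (FramedGraph.tpow K (-a)) : B.ClosingRing K k)
              = 1 := by rw [← C_mul, hmul, C_1]
          linear_combination (-B.zBot K k ⟨k, hk⟩ le_rfl) * hC
        simp only [closeStrand, aeval_X, Sum.elim_inl, dif_neg h, map_mul, algHom_C, algebraMap_eq,
          zTop, topEdge, Sum.elim_inr]
        have e' := e (ℓ (B.topEdge 0 ⟨k, hk⟩))
        simp only [zTop, zBot, topEdge, botEdge] at e'
        simp only [zBot, botEdge]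
        rw [e']
        exact Ideal.mul_mem_left _ _ (Ideal.subset_span rfl)
    · simp [closeStrand]

/-- The composition of the maps that close the strands `0, …, k - 1`, in this order. -/
def closeStrands : (k : ℕ) → B.ClosingRing K 0 →ₐ[LaurentSeries K] B.ClosingRing K k
  | 0 => AlgHom.id _ _
  | k + 1 => (B.closeStrand K ℓ k).comp (closeStrands k)

/-- The product of the variables of the top-most edges of the closed strands. -/
def zTopProd (k : ℕ) : B.ClosingRing K k := ∏ i with i.val < k, B.zTop K k i

end BraidGraph

end

/-! Closing strands sends the quadratic generator at each node to the quadratic generator at the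
same node of the closure: the `y` of the bottom edge of a closed strand becomes the `y` of the
closure edge, because the framings add. So `π(Q)` is the quadratic ideal `Q` of the closure, and the
claim concerns one graph with a set `C` of edges (the closure edges) outside of which all edges
ascend: `Q : (∏_C x_e) = N` (`quadraticIdeal_colon`).

All relations are written as `t ^ w X ^ s ≡ X ^ s'`. Up to a power of `t`, the generator of `N` at
`Γ` is such a relation, with `s - s'` the coboundary (`drop`) of the indicator function of `Γ`, and
with `w` its `twist`; both are additive in the potential.

To get `N · ∏_C x_e ⊆ Q`, remove the nodes of `Γ` from the top down, one quadratic relation each. An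
edge that leaves the highest remaining node either leaves `Γ` or lies in `C`, so its variable is
available (`rel_quadratic_of_ascending`).

Conversely, if `f · ∏_C x_e ∈ Q ⊆ N`, then `f ∈ N`, because monomials are not zero divisors modulo
`N`. Indeed `N` is a lattice ideal: it contains the relation of every integral potential
(`rel_nonlocal`). If `N` is proper, the quotient therefore embeds in a twisted group algebra of the
edge vectors modulo drops, where multiplication by a monomial is an invertible translation. -/

noncomputable section

namespace FramedGraph

/-! ### Powers of `t` -/

theorem tpow_add (K : Type*) [Field K] (m n : ℤ) : tpow K (m + n) = tpow K m * tpow K n := by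
  simp [tpow, HahnSeries.single_mul_single]

theorem tpow_zero (K : Type*) [Field K] : tpow K 0 = 1 := rfl

theorem tpow_neg_mul (K : Type*) [Field K] (n : ℤ) : tpow K (-n) * tpow K n = 1 := by
  rw [← tpow_add, neg_add_cancel, tpow_zero]

theorem tpow_sum (K : Type*) [Field K] {ι : Type*} (s : Finset ι) (f : ι → ℤ) :
    tpow K (∑ i ∈ s, f i) = ∏ i ∈ s, tpow K (f i) := by
  classical
  induction s using Finset.induction_on with
  | empty => simp
  | insert a s ha ih => rw [Finset.sum_insert ha, Finset.prod_insert ha, tpow_add, ih]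

theorem tpow_injective (K : Type*) [Field K] : Function.Injective (tpow K) := by
  intro m n h
  by_contra hne
  have := congrArg (fun f : LaurentSeries K => f.coeff m) h
  simp [tpow, HahnSeries.coeff_single_of_ne hne] at this

/-! ### Congruences between monomials -/

/-- The congruence `t ^ w X ^ s ≡ X ^ s'` modulo the ideal `I`. -/
def Rel {K : Type*} [Field K] {Edge : Type} (I : Ideal (EdgeRing K Edge)) (w : ℤ)
    (s s' : Edge →₀ ℕ) : Prop :=
  monomial s (tpow K w) - monomial s' 1 ∈ I

namespace Rel

variable {K : Type*} [Field K] {Edge : Type} {I : Ideal (EdgeRing K Edge)} {w w' : ℤ}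
  {s s' s'' a c : Edge →₀ ℕ}

theorem refl (s : Edge →₀ ℕ) : Rel I 0 s s := by
  simp [Rel]

theorem trans (h : Rel I w s s') (h' : Rel I w' s' s'') : Rel I (w + w') s s'' := by
  have e : monomial s (tpow K (w + w')) - monomial s'' 1
      = C (tpow K w') * (monomial s (tpow K w) - monomial s' 1)
        + (monomial s' (tpow K w') - monomial s'' 1) := by
    rw [mul_sub, C_mul_monomial, C_mul_monomial, mul_one, add_comm w, tpow_add]
    ring
  rw [Rel, e]
  exact I.add_mem (I.mul_mem_left _ h) h'

theorem symm (h : Rel I w s s') : Rel I (-w) s' s := by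
  have e : monomial s' (tpow K (-w)) - monomial s 1
      = -(C (tpow K (-w)) * (monomial s (tpow K w) - monomial s' 1)) := by
    rw [mul_sub, C_mul_monomial, C_mul_monomial, mul_one, tpow_neg_mul]
    ring
  rw [Rel, e]
  exact I.neg_mem (I.mul_mem_left _ h)

theorem add_right (h : Rel I w s s') (u : Edge →₀ ℕ) : Rel I w (s + u) (s' + u) := by
  have e : monomial (s + u) (tpow K w) - monomial (s' + u) 1
      = monomial u 1 * (monomial s (tpow K w) - monomial s' 1) := by
    rw [mul_sub, monomial_mul, monomial_mul, one_mul, one_mul, add_comm u, add_comm u]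
  rw [Rel, e]
  exact I.mul_mem_left _ h

/-- Multiply the given relation by the cofactor `X ^ (s - a)`; the equality of differences forces
the same cofactor on the other side. -/
theorem of_le (h : Rel I w a c) (hs : ∀ e, a e ≤ s e)
    (hd : ∀ e, (s e : ℤ) - s' e = a e - c e) : Rel I w s s' := by
  have h1 : s = a + (s - a) := by
    ext e
    have := hs e
    simp only [Finsupp.add_apply, Finsupp.tsub_apply]
    omega
  have h2 : s' = c + (s - a) := by
    ext e
    have := hs e
    have := hd e
    simp only [Finsupp.add_apply, Finsupp.tsub_apply]
    omega
  rw [h1, h2]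
  exact h.add_right _

end Rel

/-- The exponent vector of the product of the variables on the edges that satisfy `P`. -/
def indicator {Edge : Type} [Fintype Edge] (P : Edge → Prop) [DecidablePred P] : Edge →₀ ℕ :=
  ∑ e with P e, Finsupp.single e 1

theorem indicator_apply {Edge : Type} [Fintype Edge] (P : Edge → Prop) [DecidablePred P]
    (e : Edge) : indicator P e = if P e then 1 else 0 := by
  classical
  simp [indicator, Finsupp.finsetSum_apply, Finsupp.single_apply, Finset.sum_ite_eq']

theorem monomial_indicator (K : Type*) [Field K] {Edge : Type} [Fintype Edge] (P : Edge → Prop)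
    [DecidablePred P] :
    (monomial (indicator P) 1 : EdgeRing K Edge) = ∏ e with P e, X e := by
  rw [indicator, monomial_sum_one]
  rfl

variable (K : Type*) [Field K] {Node Edge : Type} (G : FramedGraph Node Edge)

theorem toEdgeRing_x (e : Edge) : G.toEdgeRing K (x K e) = X e := by
  simp [toEdgeRing, x]

theorem toEdgeRing_y (e : Edge) :
    G.toEdgeRing K (y K e) = C (tpow K (-G.framing e)) * X e := by
  simp [toEdgeRing, y]

/-- Elements that differ by a power of `t` lie in the same ideals. -/
theorem mem_of_tpow_mul_mem {I : Ideal (EdgeRing K Edge)} (n : ℤ) {f : EdgeRing K Edge}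
    (h : C (tpow K n) * f ∈ I) : f ∈ I := by
  have := I.mul_mem_left (C (tpow K (-n))) h
  rwa [← mul_assoc, ← C_mul, tpow_neg_mul, C_1, one_mul] at this

/-! ### Potentials on the nodes -/

/-- A potential on the nodes, extended by zero to the boundary. -/
def pot (p : Node → ℤ) (o : Option Node) : ℤ := o.elim 0 p

/-- The decrease of a potential along the edges. -/
def drop (p : Node → ℤ) (e : Edge) : ℤ := pot p (G.src e) - pot p (G.tgt e)

theorem pot_add (p q : Node → ℤ) (o : Option Node) : pot (p + q) o = pot p o + pot q o := by
  cases o <;> simp [pot]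

theorem pot_neg (p : Node → ℤ) (o : Option Node) : pot (-p) o = -pot p o := by
  cases o <;> simp [pot]

theorem drop_add (p q : Node → ℤ) : G.drop (p + q) = G.drop p + G.drop q := by
  ext e
  simp only [drop, pot_add, Pi.add_apply]
  ring

theorem drop_neg (p : Node → ℤ) : G.drop (-p) = -G.drop p := by
  ext e
  simp only [drop, pot_neg, Pi.neg_apply]
  ring

/-- The potential that is one on `Γ` and zero elsewhere. -/
def levelPot [DecidableEq Node] (Γ : Finset Node) (v : Node) : ℤ := if v ∈ Γ then 1 else 0

theorem pot_levelPot_src [DecidableEq Node] (Γ : Finset Node) (e : Edge) :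
    pot (levelPot Γ) (G.src e) = if G.StartsIn Γ e then 1 else 0 := by
  rcases h : G.src e with _ | v <;> simp [StartsIn, h, pot, levelPot]

theorem pot_levelPot_tgt [DecidableEq Node] (Γ : Finset Node) (e : Edge) :
    pot (levelPot Γ) (G.tgt e) = if G.EndsIn Γ e then 1 else 0 := by
  rcases h : G.tgt e with _ | v <;> simp [EndsIn, h, pot, levelPot]

theorem drop_levelPot_singleton [DecidableEq Node] (v : Node) (e : Edge) :
    G.drop (levelPot {v}) e
      = (if G.src e = some v then 1 else 0) - (if G.tgt e = some v then 1 else 0) := by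
  simp [drop, pot_levelPot_src, pot_levelPot_tgt, StartsIn, EndsIn]

variable [Fintype Edge]

theorem toEdgeRing_prod_x (P : Edge → Prop) [DecidablePred P] :
    G.toEdgeRing K (∏ e with P e, x K e) = monomial (indicator P) 1 := by
  simp only [map_prod, toEdgeRing_x, monomial_indicator]

theorem toEdgeRing_prod_y (P : Edge → Prop) [DecidablePred P] :
    G.toEdgeRing K (∏ e with P e, y K e)
      = monomial (indicator P) (tpow K (-∑ e with P e, G.framing e)) := by
  rw [← mul_one (tpow K _), ← C_mul_monomial, monomial_indicator]
  simp only [map_prod, toEdgeRing_y, Finset.prod_mul_distrib]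
  rw [← map_prod, ← tpow_sum, Finset.sum_neg_distrib]

/-- The power of `t` that comes with a potential. -/
def twist (p : Node → ℤ) : ℤ := ∑ e, G.framing e * pot p (G.tgt e)

theorem twist_add (p q : Node → ℤ) : G.twist (p + q) = G.twist p + G.twist q := by
  simp only [twist, pot_add, mul_add, Finset.sum_add_distrib]

theorem twist_neg (p : Node → ℤ) : G.twist (-p) = -G.twist p := by
  simp only [twist, pot_neg, mul_neg, Finset.sum_neg_distrib]

variable [DecidableEq Node]

theorem twist_levelPot (Γ : Finset Node) :
    G.twist (levelPot Γ) = ∑ e with G.EndsIn Γ e, G.framing e := by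
  simp only [twist, pot_levelPot_tgt, Finset.sum_filter, mul_ite, mul_one, mul_zero]

/-- The exponent vector of `x_{Γ,out}`. -/
def outExp (Γ : Finset Node) : Edge →₀ ℕ := indicator fun e => G.StartsIn Γ e ∧ ¬ G.EndsIn Γ e

/-- The exponent vector of `y_{Γ,in}`. -/
def inExp (Γ : Finset Node) : Edge →₀ ℕ := indicator fun e => G.EndsIn Γ e ∧ ¬ G.StartsIn Γ e

theorem outExp_sub_inExp (Γ : Finset Node) (e : Edge) :
    (G.outExp Γ e : ℤ) - G.inExp Γ e = G.drop (levelPot Γ) e := by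
  simp only [outExp, inExp, indicator_apply, drop, pot_levelPot_src, pot_levelPot_tgt]
  by_cases h1 : G.StartsIn Γ e <;> by_cases h2 : G.EndsIn Γ e <;> simp [h1, h2]

/-- The framings of the incoming edges clear the powers of `t` hidden in the `y`. Added to the
weight, they give the sum over all edges that end in `Γ`, which is linear in the indicator function,
unlike the weight itself. -/
theorem toEdgeRing_nonlocalGen (Γ : Finset Node) :
    C (tpow K (∑ e with G.EndsIn Γ e ∧ ¬ G.StartsIn Γ e, G.framing e))
        * G.toEdgeRing K (G.nonlocalGen K Γ)
      = monomial (G.outExp Γ) (tpow K (G.twist (levelPot Γ))) - monomial (G.inExp Γ) 1 := by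
  have h : G.twist (levelPot Γ) =
      (∑ e with G.EndsIn Γ e ∧ ¬ G.StartsIn Γ e, G.framing e) + G.weight Γ := by
    rw [twist_levelPot, weight, ← Finset.sum_filter_add_sum_filter_not
      (Finset.univ.filter (G.EndsIn Γ)) (fun e => ¬ G.StartsIn Γ e), Finset.filter_filter,
      Finset.filter_filter]
    simp only [not_not, and_comm]
  rw [nonlocalGen, map_sub, map_mul, toEdgeRing_prod_x, toEdgeRing_prod_y, algHom_C,
    algebraMap_eq, mul_sub, ← mul_assoc, ← C_mul, C_mul_monomial, C_mul_monomial, h, ← tpow_add,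
    ← tpow_add, mul_one, add_neg_cancel, tpow_zero, outExp, inExp]

theorem toEdgeRing_quadraticGen (v : Node) :
    C (tpow K (G.twist (levelPot {v}))) * G.toEdgeRing K (G.quadraticGen K v)
      = monomial (indicator fun e => G.src e = some v) (tpow K (G.twist (levelPot {v})))
        - monomial (indicator fun e => G.tgt e = some v) 1 := by
  have h : G.twist (levelPot {v}) = ∑ e with G.tgt e = some v, G.framing e := by
    rw [twist_levelPot]
    simp [EndsIn]
  rw [quadraticGen, map_sub, toEdgeRing_prod_x, toEdgeRing_prod_y, mul_sub, C_mul_monomial,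
    C_mul_monomial, h, ← tpow_add, mul_one, add_neg_cancel, tpow_zero]

theorem rel_outExp_inExp (Γ : Finset Node) :
    Rel (G.nonlocalIdeal K) (G.twist (levelPot Γ)) (G.outExp Γ) (G.inExp Γ) := by
  rw [Rel, ← toEdgeRing_nonlocalGen]
  exact Ideal.mul_mem_left _ _ (Ideal.mem_map_of_mem _ (Ideal.subset_span ⟨Γ, rfl⟩))

theorem rel_quadratic (v : Node) :
    Rel (G.quadraticIdeal K) (G.twist (levelPot {v})) (indicator fun e => G.src e = some v)
      (indicator fun e => G.tgt e = some v) := by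
  rw [Rel, ← toEdgeRing_quadraticGen]
  exact Ideal.mul_mem_left _ _ (Ideal.mem_map_of_mem _ (Ideal.subset_span ⟨v, rfl⟩))

theorem rel_nonlocal_of_le (Γ : Finset Node) {s s' : Edge →₀ ℕ}
    (hs : ∀ e, G.StartsIn Γ e → ¬ G.EndsIn Γ e → 1 ≤ s e)
    (hd : ∀ e, (s e : ℤ) - s' e = G.drop (levelPot Γ) e) :
    Rel (G.nonlocalIdeal K) (G.twist (levelPot Γ)) s s' := by
  refine (G.rel_outExp_inExp K Γ).of_le (fun e => ?_)
    (fun e => (hd e).trans (G.outExp_sub_inExp Γ e).symm)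
  rw [outExp, indicator_apply]
  split_ifs with h
  · exact hs e h.1 h.2
  · exact Nat.zero_le _

theorem rel_quadratic_of_le (v : Node) {s s' : Edge →₀ ℕ}
    (hs : ∀ e, G.src e = some v → 1 ≤ s e)
    (hd : ∀ e, (s e : ℤ) - s' e = G.drop (levelPot {v}) e) :
    Rel (G.quadraticIdeal K) (G.twist (levelPot {v})) s s' := by
  refine (G.rel_quadratic K v).of_le (fun e => ?_) (fun e => ?_)
  · rw [indicator_apply]
    split_ifs with h
    · exact hs e h
    · exact Nat.zero_le _
  · rw [hd, drop_levelPot_singleton, indicator_apply, indicator_apply]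
    push_cast
    rfl

/-- The quadratic ideal is contained in the non-local ideal. -/
theorem quadraticIdeal_le_nonlocalIdeal : G.quadraticIdeal K ≤ G.nonlocalIdeal K := by
  rw [quadraticIdeal, Ideal.map_le_iff_le_comap, Ideal.span_le]
  rintro _ ⟨v, rfl⟩
  rw [SetLike.mem_coe, Ideal.mem_comap]
  refine mem_of_tpow_mul_mem K (G.twist (levelPot {v})) (f := G.toEdgeRing K _) ?_
  rw [toEdgeRing_quadraticGen]
  refine G.rel_nonlocal_of_le K {v} (fun e h _ => ?_) (fun e => ?_)
  · rw [indicator_apply, if_pos]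
    simpa [StartsIn] using h
  · rw [drop_levelPot_singleton, indicator_apply, indicator_apply]
    push_cast
    rfl

/-! ### The non-local ideal is the lattice ideal of the cuts -/

/-- The positive part of a potential is a sum of indicators of superlevel sets. Removing `{p > 0}`
repeatedly never makes an exponent negative: on an edge that leaves this set the potential
decreases, so `s` exceeds `s' ≥ 0` there. -/
theorem rel_nonlocal_min_zero [Fintype Node] (n : ℕ) (p : Node → ℤ)
    (hn : ∑ v, (p v).toNat = n) (s s' : Edge →₀ ℕ) (hd : ∀ e, (s e : ℤ) - s' e = G.drop p e) :
    ∃ (q : Node → ℤ) (r : Edge →₀ ℕ), (∀ v, q v = min (p v) 0) ∧ (∀ e, (r e : ℤ) - s' e = G.drop q e) ∧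
      Rel (G.nonlocalIdeal K) (G.twist p - G.twist q) s r := by
  induction n using Nat.strong_induction_on generalizing p s with
  | _ n ih =>
    by_cases hp : ∀ v, p v ≤ 0
    · exact ⟨p, s, fun v => (min_eq_left (hp v)).symm, hd, by simpa using Rel.refl s⟩
    push Not at hp
    obtain ⟨v₀, hv₀⟩ := hp
    -- The boundary has potential zero, so it falls on the lower side of this cut, as the generators
    -- of `N` require.
    set Γ : Finset Node := {v | 0 < p v} with hΓ
    have hpot (o : Option Node) : pot p o ≤ 0 ∧ pot (levelPot Γ) o = 0 ∨
        0 < pot p o ∧ pot (levelPot Γ) o = 1 := by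
      cases o with
      | none => simp [pot]
      | some v =>
        rcases le_or_gt (p v) 0 with h | h
        · exact Or.inl ⟨h, by simp [pot, levelPot, hΓ, h]⟩
        · exact Or.inr ⟨h, by simp [pot, levelPot, hΓ, h]⟩
    have hnn (e : Edge) : 0 ≤ (s e : ℤ) - G.drop (levelPot Γ) e := by
      have h1 := hpot (G.src e)
      have h2 := hpot (G.tgt e)
      have h3 := hd e
      rw [drop] at h3 ⊢
      omega
    set r : Edge →₀ ℕ := Finsupp.equivFunOnFinite.symm
      fun e => ((s e : ℤ) - G.drop (levelPot Γ) e).toNat with hr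
    have hre (e : Edge) : (r e : ℤ) = (s e : ℤ) - G.drop (levelPot Γ) e := by
      simp only [hr, Finsupp.equivFunOnFinite_symm_apply_apply]
      exact Int.toNat_of_nonneg (hnn e)
    have hrel : Rel (G.nonlocalIdeal K) (G.twist (levelPot Γ)) s r := by
      refine G.rel_nonlocal_of_le K Γ (fun e h1 h2 => ?_) (fun e => by rw [hre]; ring)
      have h3 := hpot (G.src e)
      have h4 := hpot (G.tgt e)
      have h5 := hd e
      rw [pot_levelPot_src, if_pos h1] at h3
      rw [pot_levelPot_tgt, if_neg h2] at h4
      rw [drop] at h5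
      omega
    have hlt : ∑ v, ((p + -levelPot Γ) v).toNat < n := by
      rw [← hn]
      refine Finset.sum_lt_sum (fun v _ => ?_) ⟨v₀, Finset.mem_univ _, ?_⟩
      · have : 0 ≤ levelPot Γ v := by unfold levelPot; split_ifs <;> norm_num
        simp only [Pi.add_apply, Pi.neg_apply]
        omega
      · have : levelPot Γ v₀ = 1 := by simp [levelPot, hΓ, hv₀]
        simp only [Pi.add_apply, Pi.neg_apply]
        omega
    obtain ⟨q, r', hq, hd', hR⟩ := ih _ hlt (p + -levelPot Γ) rfl r (fun e => by
      rw [hre, drop_add, drop_neg, Pi.add_apply, Pi.neg_apply, ← hd]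
      ring)
    refine ⟨q, r', fun v => ?_, hd', ?_⟩
    · have h1 := hq v
      have h2 := hpot (some v)
      simp only [pot, Option.elim] at h2
      simp only [Pi.add_apply, Pi.neg_apply] at h1
      omega
    have := hrel.trans hR
    rwa [twist_add, twist_neg, show G.twist (levelPot Γ)
      + (G.twist p + -G.twist (levelPot Γ) - G.twist q) = G.twist p - G.twist q by ring] at this

/-- Monomials whose exponents differ by the drop of a potential are proportional modulo the
non-local ideal. -/
theorem rel_nonlocal [Fintype Node] (p : Node → ℤ) {s s' : Edge →₀ ℕ}
    (hd : ∀ e, (s e : ℤ) - s' e = G.drop p e) :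
    Rel (G.nonlocalIdeal K) (G.twist p) s s' := by
  obtain ⟨q, r, hq, hqd, hR⟩ := G.rel_nonlocal_min_zero K _ p rfl s s' hd
  -- What remains is `q ≤ 0`. Read from `s'` to `r`, the potential is `-q ≥ 0`, so the same
  -- reduction starting at `s'` leaves nothing over and ends at `r`.
  obtain ⟨q', r', hq', hqd', hR'⟩ := G.rel_nonlocal_min_zero K _ (-q) rfl s' r (fun e => by
    rw [drop_neg, Pi.neg_apply, ← hqd]; ring)
  obtain rfl : q' = 0 := by
    ext v
    have := hq v
    have := hq' v
    simp only [Pi.neg_apply, Pi.zero_apply] at *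
    omega
  obtain rfl : r' = r := by
    ext e
    have h := hqd' e
    have h0 : pot (0 : Node → ℤ) = 0 := by
      ext o
      cases o <;> rfl
    simp only [drop, h0, Pi.zero_apply] at h
    omega
  have := hR.trans hR'.symm
  have h0 : G.twist 0 = 0 := by simpa using G.twist_add 0 0
  rwa [twist_neg, h0, show G.twist p - G.twist q + -(-G.twist q - 0) = G.twist p by ring] at this

end FramedGraph

/-! ### The twisted group algebra of edge vectors modulo drops -/

namespace FramedGraph

/-- The drop of a potential, as a homomorphism. -/
def dropHom {Node Edge : Type} (G : FramedGraph Node Edge) : (Node → ℤ) →+ (Edge → ℤ) :=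
  AddMonoidHom.mk' G.drop G.drop_add

/-- Given a function `κ` on the integral edge vectors, the normalized value of a vector: the value
of `κ` on the difference with the representative of its class modulo drops of potentials. -/
def excess {Node Edge : Type} (G : FramedGraph Node Edge) (κ : (Edge → ℤ) → ℤ) (z : Edge → ℤ) : ℤ :=
  κ (z - Quotient.out (z : (Edge → ℤ) ⧸ G.dropHom.range))

/-- An exponent vector as an integral vector. -/
def intVec {Edge : Type} (s : Edge →₀ ℕ) (e : Edge) : ℤ := s e

theorem intVec_add {Edge : Type} (s u : Edge →₀ ℕ) : intVec (s + u) = intVec s + intVec u := by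
  ext e
  simp [intVec]

section Lattice

variable (K : Type*) [Field K] {Node Edge : Type} (G : FramedGraph Node Edge) [Fintype Edge]

/-- Such a potential puts the scalar `t ^ twist - 1` into the ideal, and this is a unit unless the
twist vanishes. -/
theorem twist_eq_zero_of_drop_eq_zero [DecidableEq Node] [Fintype Node]
    (hN : G.nonlocalIdeal K ≠ ⊤) (p : Node → ℤ) (hp : G.drop p = 0) : G.twist p = 0 := by
  by_contra hne
  refine hN (Ideal.eq_top_of_isUnit_mem _ (G.rel_nonlocal K p (s := 0) (s' := 0) (by simp [hp])) ?_)
  rw [← map_sub]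
  refine (isUnit_iff_ne_zero.mpr (sub_ne_zero.mpr fun h => hne ?_)).map C
  exact tpow_injective K h

variable (κ : (Edge → ℤ) → ℤ)

/-- The class of a monomial modulo drops of potentials, with its power of `t`. -/
def classMap : EdgeRing K Edge →ₗ[LaurentSeries K]
    ((Edge → ℤ) ⧸ G.dropHom.range) →₀ LaurentSeries K :=
  (basisMonomials Edge (LaurentSeries K)).constr (LaurentSeries K) fun s =>
    Finsupp.single (intVec s : (Edge → ℤ) ⧸ G.dropHom.range) (tpow K (-G.excess κ (intVec s)))

theorem classMap_monomial (s : Edge →₀ ℕ) (r : LaurentSeries K) :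
    G.classMap K κ (monomial s r) = r • Finsupp.single
      (intVec s : (Edge → ℤ) ⧸ G.dropHom.range) (tpow K (-G.excess κ (intVec s))) := by
  have h : monomial s r = r • basisMonomials Edge (LaurentSeries K) s := by
    simp [coe_basisMonomials, smul_monomial]
  rw [h, map_smul, classMap, Module.Basis.constr_basis]

/-- Translation of classes. -/
def classShift (u : Edge → ℤ) : (((Edge → ℤ) ⧸ G.dropHom.range) →₀ LaurentSeries K)
    →ₗ[LaurentSeries K] ((Edge → ℤ) ⧸ G.dropHom.range) →₀ LaurentSeries K :=
  Finsupp.linearCombination _ fun d => Finsupp.single (d + (u : (Edge → ℤ) ⧸ G.dropHom.range))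
    (tpow K (-κ (Quotient.out d + u - Quotient.out (d + (u : (Edge → ℤ) ⧸ G.dropHom.range)))))

variable {κ} (hκ : ∀ p, κ (G.drop p) = G.twist p)
include hκ

theorem kappa_add {z z' : Edge → ℤ} (hz : z ∈ G.dropHom.range) (hz' : z' ∈ G.dropHom.range) :
    κ (z + z') = κ z + κ z' := by
  obtain ⟨p, rfl⟩ := hz
  obtain ⟨q, rfl⟩ := hz'
  rw [← map_add]
  exact (hκ _).trans ((G.twist_add p q).trans (by rw [← hκ, ← hκ]; rfl))

/-- Both vectors have the same class representative, so their normalized values differ by `κ` of a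
drop. -/
theorem excess_sub {z z' : Edge → ℤ} {p : Node → ℤ} (h : z - z' = G.drop p) :
    G.excess κ z = G.twist p + G.excess κ z' := by
  have hzz : (z : (Edge → ℤ) ⧸ G.dropHom.range) = z' := by
    rw [eq_comm, QuotientAddGroup.eq, neg_add_eq_sub, h]
    exact ⟨p, rfl⟩
  rw [excess, excess, hzz, ← hκ, ← h, ← G.kappa_add hκ]
  · congr 1
    abel
  · exact ⟨p, h.symm⟩
  · rw [← neg_add_eq_sub, ← QuotientAddGroup.eq]
    exact Quotient.out_eq _

/-- The scalar in `classShift` accounts for the change of representatives: its argument and that of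
the old excess are drops whose sum is the argument of the new excess. -/
theorem classShift_single (u z : Edge → ℤ) :
    G.classShift K κ u (Finsupp.single (z : (Edge → ℤ) ⧸ G.dropHom.range)
      (tpow K (-G.excess κ z))) = Finsupp.single
      ((z + u : Edge → ℤ) : (Edge → ℤ) ⧸ G.dropHom.range) (tpow K (-G.excess κ (z + u))) := by
  rw [classShift, Finsupp.linearCombination_single, Finsupp.smul_single, smul_eq_mul, ← tpow_add,
    ← QuotientAddGroup.mk_add, ← neg_add]
  congr 3
  rw [excess, excess, ← G.kappa_add hκ]
  · congr 1
    abel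
  · rw [← neg_add_eq_sub, ← QuotientAddGroup.eq]
    exact Quotient.out_eq _
  · rw [← neg_add_eq_sub, ← QuotientAddGroup.eq]
    refine (Quotient.out_eq _).trans ?_
    rw [QuotientAddGroup.mk_add, QuotientAddGroup.mk_add]
    congr 1
    exact (Quotient.out_eq _).symm

theorem classMap_monomial_mul (u : Edge →₀ ℕ) (r : LaurentSeries K) (f : EdgeRing K Edge) :
    G.classMap K κ (monomial u r * f) = r • G.classShift K κ (intVec u) (G.classMap K κ f) := by
  induction f using MvPolynomial.induction_on' with
  | add p q hp hq => rw [mul_add, map_add, hp, hq, map_add, map_add, smul_add]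
  | monomial s a =>
    rw [monomial_mul, classMap_monomial, classMap_monomial, map_smul, G.classShift_single K hκ,
      add_comm u, intVec_add, mul_smul]

/-- In the group algebra a monomial can be divided out. This is what makes it a nonzerodivisor
modulo the kernel of `classMap`. -/
theorem classShift_neg_classMap (u : Edge →₀ ℕ) (f : EdgeRing K Edge) :
    G.classShift K κ (-intVec u) (G.classMap K κ (monomial u 1 * f)) = G.classMap K κ f := by
  induction f using MvPolynomial.induction_on' with
  | add p q hp hq => rw [mul_add, map_add, map_add, hp, hq, map_add]
  | monomial s a =>
    rw [monomial_mul, classMap_monomial, classMap_monomial, map_smul, G.classShift_single K hκ,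
      one_mul, add_comm u, intVec_add, add_neg_cancel_right]

theorem classMap_mul_eq_zero {f : EdgeRing K Edge} (hf : G.classMap K κ f = 0)
    (g : EdgeRing K Edge) : G.classMap K κ (g * f) = 0 := by
  induction g using MvPolynomial.induction_on' with
  | add p q hp hq => rw [add_mul, map_add, hp, hq, add_zero]
  | monomial s a => rw [G.classMap_monomial_mul K hκ, hf, map_zero, smul_zero]

variable [DecidableEq Node]

/-- The two monomials of a generator have the same class, and their excesses differ by exactly the
twist. -/
theorem classMap_of_mem {f : EdgeRing K Edge} (hf : f ∈ G.nonlocalIdeal K) :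
    G.classMap K κ f = 0 := by
  rw [nonlocalIdeal, Ideal.map_span] at hf
  induction hf using Submodule.span_induction with
  | zero => exact map_zero _
  | add p q _ _ hp hq => rw [map_add, hp, hq, add_zero]
  | smul g p _ hp => exact G.classMap_mul_eq_zero K hκ hp g
  | mem p hp =>
    obtain ⟨_, ⟨Γ, rfl⟩, rfl⟩ := hp
    set n := ∑ e with G.EndsIn Γ e ∧ ¬ G.StartsIn Γ e, G.framing e
    have h : G.toEdgeRing K (G.nonlocalGen K Γ) = C (tpow K (-n)) *
        (monomial (G.outExp Γ) (tpow K (G.twist (levelPot Γ))) - monomial (G.inExp Γ) 1) := by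
      rw [← toEdgeRing_nonlocalGen, ← mul_assoc, ← C_mul, tpow_neg_mul, C_1, one_mul]
    rw [h]
    refine G.classMap_mul_eq_zero K hκ ?_ _
    have hd : intVec (G.outExp Γ) - intVec (G.inExp Γ) = G.drop (levelPot Γ) :=
      funext (G.outExp_sub_inExp Γ)
    have hq : (intVec (G.outExp Γ) : (Edge → ℤ) ⧸ G.dropHom.range) = intVec (G.inExp Γ) := by
      rw [eq_comm, QuotientAddGroup.eq, neg_add_eq_sub, hd]
      exact ⟨_, rfl⟩
    rw [map_sub, classMap_monomial, classMap_monomial, hq, Finsupp.smul_single, smul_eq_mul,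
      one_smul, ← tpow_add, G.excess_sub hκ hd, neg_add_rev, add_comm, neg_add_cancel_right,
      sub_self]

theorem mem_of_classMap [Fintype Node] {f : EdgeRing K Edge} (hf : G.classMap K κ f = 0) :
    f ∈ G.nonlocalIdeal K := by
  classical
  -- A left inverse modulo `N`: each class goes to a chosen monomial in it, rescaled. Classes
  -- without a monomial get the default `0`; they do not occur in the image of `classMap`.
  let S : (((Edge → ℤ) ⧸ G.dropHom.range) →₀ LaurentSeries K) →ₗ[LaurentSeries K]
      EdgeRing K Edge ⧸ G.nonlocalIdeal K :=
    Finsupp.linearCombination _ fun d =>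
      if h : ∃ s : Edge →₀ ℕ, (intVec s : (Edge → ℤ) ⧸ G.dropHom.range) = d then
        Ideal.Quotient.mk _ (monomial h.choose (tpow K (G.excess κ (intVec h.choose))))
      else 0
  have hS (g : EdgeRing K Edge) : S (G.classMap K κ g) = Ideal.Quotient.mk _ g := by
    induction g using MvPolynomial.induction_on' with
    | add p q hp hq => rw [map_add, map_add, map_add, hp, hq]
    | monomial s a =>
      have h : ∃ s' : Edge →₀ ℕ, (intVec s' : (Edge → ℤ) ⧸ G.dropHom.range) = intVec s := ⟨s, rfl⟩
      simp only [S, classMap_monomial, map_smul, Finsupp.linearCombination_single]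
      rw [dif_pos h]
      set s' := h.choose
      have hs' : (intVec s' : (Edge → ℤ) ⧸ G.dropHom.range) = intVec s := h.choose_spec
      rw [QuotientAddGroup.eq, neg_add_eq_sub] at hs'
      obtain ⟨p, hp⟩ := hs'
      have hp' : intVec s - intVec s' = G.drop p := hp.symm
      have hR : Rel (G.nonlocalIdeal K) (G.twist p) s s' := G.rel_nonlocal K p (congrFun hp')
      have hm (r : LaurentSeries K) (x : EdgeRing K Edge) :
          r • Ideal.Quotient.mk (G.nonlocalIdeal K) x = Ideal.Quotient.mk _ (C r * x) := by
        rw [← smul_eq_C_mul]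
        rfl
      rw [hm, hm, Ideal.Quotient.eq, ← neg_mem_iff]
      have e : -(C a * (C (tpow K (-G.excess κ (intVec s)))
            * monomial s' (tpow K (G.excess κ (intVec s')))) - monomial s a)
          = C (a * tpow K (-G.twist p)) * (monomial s (tpow K (G.twist p)) - monomial s' 1) := by
        rw [G.excess_sub hκ hp', mul_sub, C_mul_monomial, C_mul_monomial, C_mul_monomial,
          C_mul_monomial, ← tpow_add, mul_assoc, tpow_neg_mul, mul_one, mul_one, neg_add,
          neg_add_cancel_right]
        ring
      rw [e]
      exact Ideal.mul_mem_left _ _ hR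
  rw [← Ideal.Quotient.eq_zero_iff_mem, ← hS, hf, map_zero]

end Lattice

/-! ### Monomials modulo the non-local ideal, and the ideal quotient -/

section

variable (K : Type*) [Field K] {Node Edge : Type} (G : FramedGraph Node Edge) [Fintype Edge]
  [DecidableEq Node]

/-- Monomials are not zero divisors modulo the non-local ideal. -/
theorem mem_nonlocalIdeal_of_monomial_mul_mem [Fintype Node] (u : Edge →₀ ℕ) {f : EdgeRing K Edge}
    (hf : monomial u 1 * f ∈ G.nonlocalIdeal K) : f ∈ G.nonlocalIdeal K := by
  classical
  -- The improper case is separate because a potential of zero drop may then have nonzero twist, and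
  -- the twist is no longer a function of the drop.
  by_cases hN : G.nonlocalIdeal K = ⊤
  · rw [hN]
    exact Submodule.mem_top
  -- The twist as a function of the drop. The value off the lattice of drops is immaterial.
  let κ : (Edge → ℤ) → ℤ := fun z => if h : ∃ p, G.drop p = z then G.twist h.choose else 0
  have hκ (p : Node → ℤ) : κ (G.drop p) = G.twist p := by
    have h : ∃ q, G.drop q = G.drop p := ⟨p, rfl⟩
    simp only [κ]
    rw [dif_pos h]
    have h0 := G.twist_eq_zero_of_drop_eq_zero K hN (h.choose + -p) (by
      rw [drop_add, drop_neg, h.choose_spec, add_neg_cancel])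
    rw [twist_add, twist_neg] at h0
    linarith
  refine G.mem_of_classMap K hκ ?_
  rw [← G.classShift_neg_classMap K hκ u, G.classMap_of_mem K hκ hf, map_zero]

/-- In a graph in which the edges outside of a set `C` are ascending, the relation of a set of nodes
follows from the quadratic relations, for monomials that are divisible by the variables of the edges
that leave the set and of those edges of `C` that start in the set. -/
theorem rel_quadratic_of_ascending (C : Edge → Prop) (ord : Node → ℕ)
    (hC : ∀ e, ¬ C e → ∀ u v, G.src e = some u → G.tgt e = some v → ord u < ord v)
    (Γ : Finset Node) {s s' : Edge →₀ ℕ}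
    (hs : ∀ e, G.StartsIn Γ e → (C e ∨ ¬ G.EndsIn Γ e) → 1 ≤ s e)
    (hd : ∀ e, (s e : ℤ) - s' e = G.drop (levelPot Γ) e) :
    Rel (G.quadraticIdeal K) (G.twist (levelPot Γ)) s s' := by
  induction Γ using Finset.strongInduction generalizing s with
  | _ Γ ih =>
    rcases Γ.eq_empty_or_nonempty with rfl | hne
    · have h0 (e : Edge) : G.drop (levelPot ∅) e = 0 := by
        simp [drop, pot_levelPot_src, pot_levelPot_tgt, StartsIn, EndsIn]
      obtain rfl : s = s' := by
        ext e
        have := hd e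
        rw [h0] at this
        omega
      have h1 : G.twist (levelPot ∅) = 0 := by simp [twist_levelPot, EndsIn]
      rw [h1]
      exact Rel.refl s
    · obtain ⟨m, hm, hmax⟩ := Γ.exists_max_image ord hne
      have hl : levelPot Γ = levelPot {m} + levelPot (Γ.erase m) := by
        ext v
        simp only [levelPot, Pi.add_apply, Finset.mem_singleton, Finset.mem_erase]
        by_cases h : v = m <;> simp [h, hm]
      -- An edge from the highest node `m` back into `Γ` cannot ascend, so it lies in `C`.
      have hsrc (e : Edge) (he : G.src e = some m) : 1 ≤ s e := by
        refine hs e ⟨m, hm, he⟩ (or_iff_not_imp_left.mpr fun h => ?_)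
        rintro ⟨v, hv, hev⟩
        exact absurd (hC e h m v he hev) (not_lt.mpr (hmax v hv))
      let r : Edge →₀ ℕ := Finsupp.equivFunOnFinite.symm
        fun e => ((s e : ℤ) - G.drop (levelPot {m}) e).toNat
      have hr (e : Edge) : (r e : ℤ) = s e - G.drop (levelPot {m}) e := by
        refine Int.toNat_of_nonneg ?_
        have := hsrc e
        rw [drop_levelPot_singleton]
        split_ifs <;> simp_all <;> omega
      have h1 : Rel (G.quadraticIdeal K) (G.twist (levelPot {m})) s r :=
        G.rel_quadratic_of_le K m hsrc fun e => by rw [hr]; ring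
      rw [hl, twist_add]
      refine h1.trans (ih _ (Finset.erase_ssubset hm) ?_ fun e => ?_)
      · rintro e ⟨u, hu, heu⟩ he
        obtain ⟨hum, hu⟩ := Finset.mem_erase.mp hu
        have hre := hr e
        rw [drop_levelPot_singleton, if_neg (by rw [heu]; simpa using hum)] at hre
        -- An edge from the rest of `Γ` into `m` may be new to the hypothesis, since it now leaves
        -- the smaller set; but the relation at `m` has just supplied its variable.
        by_cases ht : G.tgt e = some m
        · rw [if_pos ht] at hre
          omega
        · rw [if_neg ht] at hre
          have : 1 ≤ s e := by
            refine hs e ⟨u, hu, heu⟩ (he.imp_right fun h => ?_)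
            rintro ⟨v, hv, hev⟩
            refine h ⟨v, Finset.mem_erase.mpr ⟨?_, hv⟩, hev⟩
            rintro rfl
            exact ht hev
          omega
      · rw [hr]
        have := hd e
        rw [hl, drop_add, Pi.add_apply] at this
        linarith

/-- In a graph in which the edges outside of a set `C` are ascending, the non-local ideal is the
quotient of the quadratic ideal by the product of the variables on the edges in `C`. -/
theorem quadraticIdeal_colon [Fintype Node] (C : Edge → Prop) [DecidablePred C] (ord : Node → ℕ)
    (hC : ∀ e, ¬ C e → ∀ u v, G.src e = some u → G.tgt e = some v → ord u < ord v) :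
    (G.quadraticIdeal K).colon (Ideal.span {∏ e with C e, X e} : Ideal (EdgeRing K Edge))
      = G.nonlocalIdeal K := by
  refine le_antisymm (fun f hf => ?_) ?_
  · rw [Ideal.mem_colon_span_singleton, mul_comm, ← monomial_indicator] at hf
    exact G.mem_nonlocalIdeal_of_monomial_mul_mem K _ (G.quadraticIdeal_le_nonlocalIdeal K hf)
  · rw [nonlocalIdeal, Ideal.map_le_iff_le_comap, Ideal.span_le]
    rintro _ ⟨Γ, rfl⟩
    rw [SetLike.mem_coe, Ideal.mem_comap, Ideal.mem_colon_span_singleton]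
    refine mem_of_tpow_mul_mem K (∑ e with G.EndsIn Γ e ∧ ¬ G.StartsIn Γ e, G.framing e) ?_
    rw [← mul_assoc, toEdgeRing_nonlocalGen, ← monomial_indicator, sub_mul, monomial_mul,
      monomial_mul, mul_one, mul_one]
    -- The factor `x_{Γ,out}` supplies the variables of the edges leaving `Γ`, the product over `C`
    -- those of the edges in `C`.
    refine G.rel_quadratic_of_ascending K C ord hC Γ (fun e h1 h2 => ?_) fun e => ?_
    · rw [Finsupp.add_apply, outExp, indicator_apply, indicator_apply]
      rcases h2 with h2 | h2 <;> simp [h1, h2]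
    · rw [← outExp_sub_inExp, Finsupp.add_apply, Finsupp.add_apply]
      push_cast
      ring

end

end FramedGraph

/-! ### Closures of braid graphs -/

namespace BraidGraph

variable {b : ℕ} (B : BraidGraph b) (K : Type*) [Field K] (ℓ : B.Edge 0 → ℤ)

/-- A bottom variable changes only when its own strand is closed; it then becomes a multiple of a
top variable, which all later closings fix. -/
theorem closeStrands_X_inl (k : ℕ) (i : {i : Fin b // 0 ≤ i.val}) :
    B.closeStrands K ℓ k (X (Sum.inl i)) = if h : k ≤ i.1.val then B.zBot K k i.1 h
      else C (FramedGraph.tpow K (-ℓ (B.topEdge 0 i.1))) * B.zTop K k i.1 := by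
  induction k with
  | zero => rw [dif_pos i.2]; rfl
  | succ k ih =>
    rw [closeStrands, AlgHom.comp_apply, ih]
    by_cases h : k ≤ i.1.val
    · rw [dif_pos h]
      simp [closeStrand, zBot, botEdge]
    · rw [dif_neg h, dif_neg (by omega)]
      simp [closeStrand, zTop, topEdge, algHom_C]

theorem closeStrands_X_inr (k : ℕ)
    (p : {p : Fin B.size × Fin b // p.2 ∈ (B.node p.1).strands}) :
    B.closeStrands K ℓ k (X (Sum.inr p)) = X (Sum.inr p) := by
  induction k with
  | zero => rfl
  | succ k ih => rw [closeStrands, AlgHom.comp_apply, ih]; simp [closeStrand]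

theorem eq_topEdge_iff (p : {p : Fin B.size × Fin b // p.2 ∈ (B.node p.1).strands}) :
    p.1.1 = B.topNode p.1.2 ↔ ¬ (B.nodesAbove p.1.1 p.1.2).Nonempty := by
  have hp : p.1.1 ∈ B.nodesOn p.1.2 := by simpa [nodesOn] using p.2
  constructor
  · rintro h ⟨w, hw⟩
    rw [nodesAbove, Finset.mem_filter, h] at hw
    exact absurd ((B.nodesOn p.1.2).le_max' w hw.1) (not_le.mpr hw.2)
  · intro h
    refine le_antisymm ((B.nodesOn p.1.2).le_max' _ hp) (not_lt.mp fun hlt => h ⟨B.topNode p.1.2, ?_⟩)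
    rw [nodesAbove, Finset.mem_filter]
    exact ⟨(B.nodesOn p.1.2).max'_mem _, hlt⟩

/-- The edges of the closing that close a strand. -/
def IsClosure (k : ℕ) : B.Edge k → Prop :=
  Sum.elim (fun _ => False) fun p => p.1.1 = B.topNode p.1.2 ∧ p.1.2.val < k

instance (k : ℕ) : DecidablePred (B.IsClosure k)
  | .inl _ => inferInstanceAs (Decidable False)
  | .inr p => inferInstanceAs (Decidable (p.1.1 = B.topNode p.1.2 ∧ p.1.2.val < k))

/-- A product over the closure edges is a product over the closed strands. -/
theorem prod_closure {M : Type*} [CommMonoid M] (k : ℕ)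
    (f : {p : Fin B.size × Fin b // p.2 ∈ (B.node p.1).strands} → M) :
    ∏ p, (if p.1.1 = B.topNode p.1.2 ∧ p.1.2.val < k then f p else 1)
      = ∏ i : Fin b with i.val < k, f ⟨(B.topNode i, i), B.mem_strands_topNode i⟩ := by
  rw [← Finset.prod_filter]
  symm
  refine Finset.prod_bij (fun i _ => ⟨(B.topNode i, i), B.mem_strands_topNode i⟩) ?_ ?_ ?_ ?_
  · intro i hi
    simpa using hi
  · intro i _ j _ h
    exact congrArg (fun p => p.1.2) h
  · rintro ⟨⟨v, i⟩, hp⟩ h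
    simp only [Finset.mem_filter, Finset.mem_univ, true_and] at h
    obtain ⟨rfl, h⟩ := h
    exact ⟨i, by simpa using h, rfl⟩
  · intro i _
    rfl

theorem isClosure_inl (k : ℕ) (i : {i : Fin b // k ≤ i.val}) :
    B.IsClosure k (Sum.inl i) ↔ False := Iff.rfl

theorem isClosure_inr (k : ℕ) (p : {p : Fin B.size × Fin b // p.2 ∈ (B.node p.1).strands}) :
    B.IsClosure k (Sum.inr p) ↔ p.1.1 = B.topNode p.1.2 ∧ p.1.2.val < k := Iff.rfl

theorem prod_isClosure (k : ℕ) : ∏ e with B.IsClosure k e, X e = B.zTopProd K k := by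
  rw [Finset.prod_filter, Fintype.prod_sum_type]
  simp only [isClosure_inl, isClosure_inr, if_false, Finset.prod_const_one, one_mul]
  rw [prod_closure B k fun p => (X (Sum.inr p) : B.ClosingRing K k)]
  rfl

theorem tgt_inl (k : ℕ) (i : {i : Fin b // k ≤ i.val}) (v : Fin B.size) :
    (B.closing ℓ k).tgt (Sum.inl i) = some v ↔ B.botNode i.1 = v := Option.some_inj

/-- The factor of an edge that leaves a node in the product over the edges that end at `v`: it
arises from the open graph, except for the closure edges. -/
theorem inr_factor (k : ℕ) (v : Fin B.size)
    (p : {p : Fin B.size × Fin b // p.2 ∈ (B.node p.1).strands}) :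
    (if (B.closing ℓ k).tgt (Sum.inr p) = some v then
      C (FramedGraph.tpow K (-(B.closing ℓ k).framing (Sum.inr p))) * X (Sum.inr p) else 1 :
        B.ClosingRing K k)
    = (if (B.closing ℓ 0).tgt (Sum.inr p) = some v then
        C (FramedGraph.tpow K (-(B.closing ℓ 0).framing (Sum.inr p))) * X (Sum.inr p) else 1) *
      (if p.1.1 = B.topNode p.1.2 ∧ p.1.2.val < k then
        if B.botNode p.1.2 = v then C (FramedGraph.tpow K
          (-(ℓ (Sum.inr p) + ℓ (B.botEdge p.1.2 (Nat.zero_le _))))) * X (Sum.inr p) else 1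
      else 1) := by
  simp only [closing, Nat.not_lt_zero, and_false, if_false]
  by_cases h : (B.nodesAbove p.1.1 p.1.2).Nonempty
  · have ht : ¬ p.1.1 = B.topNode p.1.2 := fun ht => (B.eq_topEdge_iff p).mp ht h
    simp [h, ht]
  · have ht := (B.eq_topEdge_iff p).mpr h
    by_cases hk : p.1.2.val < k
    · simp only [dif_neg h, if_pos hk, if_pos (And.intro ht hk), reduceCtorEq, if_false, one_mul,
        Option.some.injEq]
    · simp only [dif_neg h, hk, and_false, reduceCtorEq, if_false, one_mul]

/-- Closing strands maps the quadratic generators to those of the closing. -/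
theorem closeStrands_quadraticGen (k : ℕ) (v : Fin B.size) :
    B.closeStrands K ℓ k ((B.closing ℓ 0).toEdgeRing K ((B.closing ℓ 0).quadraticGen K v))
      = (B.closing ℓ k).toEdgeRing K ((B.closing ℓ k).quadraticGen K v) := by
  simp only [FramedGraph.quadraticGen, map_sub, map_prod, FramedGraph.toEdgeRing_x,
    FramedGraph.toEdgeRing_y, map_mul, algHom_C, algebraMap_eq]
  congr 1
  · simp only [Finset.prod_filter, Fintype.prod_sum_type, closeStrands_X_inr]
    simp [closing]
  · simp only [Finset.prod_filter, Fintype.prod_sum_type, closeStrands_X_inl, closeStrands_X_inr]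
    simp only [tgt_inl, inr_factor B K ℓ k v, Finset.prod_mul_distrib]
    rw [mul_left_comm, mul_comm]
    congr 1
    rw [B.prod_closure k fun p => if B.botNode p.1.2 = v then
      C (FramedGraph.tpow K (-(ℓ (Sum.inr p) + ℓ (B.botEdge p.1.2 (Nat.zero_le _)))))
        * (X (Sum.inr p) : B.ClosingRing K k) else 1]
    have hsub : ∏ i : {i : Fin b // 0 ≤ i.val}, (if B.botNode i.1 = v then
          C (FramedGraph.tpow K (-(B.closing ℓ 0).framing (Sum.inl i))) *
            (if h : k ≤ i.1.val then B.zBot K k i.1 h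
              else C (FramedGraph.tpow K (-ℓ (B.topEdge 0 i.1))) * B.zTop K k i.1)
          else 1 : B.ClosingRing K k)
        = ∏ i : Fin b, (if B.botNode i = v then
          C (FramedGraph.tpow K (-ℓ (B.botEdge i (Nat.zero_le _)))) *
            (if h : k ≤ i.val then B.zBot K k i h
              else C (FramedGraph.tpow K (-ℓ (B.topEdge 0 i))) * B.zTop K k i)
          else 1 : B.ClosingRing K k) :=
      Fintype.prod_equiv (Equiv.subtypeUnivEquiv fun _ => Nat.zero_le _) _ _ fun i => rfl
    -- Bottom edges of the open strands survive unchanged; those of the closed strands have to match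
    -- the closure edges that end at `v`.
    rw [hsub, ← Fintype.prod_subtype_mul_prod_subtype (fun i : Fin b => k ≤ i.val)]
    congr 1
    · refine Finset.prod_congr rfl fun i _ => ?_
      rw [dif_pos i.2]
      rfl
    · rw [← Finset.prod_subtype (p := fun i : Fin b => ¬ k ≤ i.val)
        (Finset.univ.filter fun i : Fin b => i.val < k) (by simp)
        (fun i : Fin b => (if B.botNode i = v then
          C (FramedGraph.tpow K (-ℓ (B.botEdge i (Nat.zero_le _)))) *
            (if h : k ≤ i.val then B.zBot K k i h
              else C (FramedGraph.tpow K (-ℓ (B.topEdge 0 i))) * B.zTop K k i)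
          else 1 : B.ClosingRing K k))]
      refine Finset.prod_congr rfl fun i hi => ?_
      rw [dif_neg (by simpa using hi), ← mul_assoc, ← C_mul, ← FramedGraph.tpow_add, neg_add_rev]
      rfl

theorem map_quadraticIdeal (k : ℕ) :
    ((B.closing ℓ 0).quadraticIdeal K).map (B.closeStrands K ℓ k)
      = (B.closing ℓ k).quadraticIdeal K := by
  rw [FramedGraph.quadraticIdeal, FramedGraph.quadraticIdeal, Ideal.map_span, Ideal.map_span,
    Ideal.map_span, ← Set.range_comp, ← Set.range_comp, ← Set.range_comp]
  exact congrArg (fun g => Ideal.span (Set.range g)) (funext (B.closeStrands_quadraticGen K ℓ k))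

/-- Nodes are listed from bottom to top, and an edge that does not close a strand runs to the next
node above on its strand or to the boundary. -/
theorem closing_ascending (k : ℕ) (e : B.Edge k) (he : ¬ B.IsClosure k e) (u v : Fin B.size)
    (hu : (B.closing ℓ k).src e = some u) (hv : (B.closing ℓ k).tgt e = some v) :
    u.val < v.val := by
  rcases e with i | p
  · simp [closing] at hu
  · simp only [closing, Option.some.injEq] at hu hv
    subst hu
    by_cases h : (B.nodesAbove p.1.1 p.1.2).Nonempty
    · rw [dif_pos h, Option.some.injEq] at hv
      have := (B.nodesAbove p.1.1 p.1.2).min'_mem h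
      rw [hv, nodesAbove, Finset.mem_filter] at this
      exact this.2
    · rw [dif_neg h] at hv
      split_ifs at hv with hk
      exact absurd ⟨(B.eq_topEdge_iff p).mpr h, hk⟩ he

end BraidGraph

end

theorem corollary1p2 (K : Type*) [Field K] (b : ℕ) (hb : 1 ≤ b) (B : BraidGraph b)
    (ℓ : B.Edge 0 → ℤ) :
    (((B.closing ℓ 0).quadraticIdeal K).map (B.closeStrands K ℓ (b - 1))).colon
        (Ideal.span {B.zTopProd K (b - 1)} : Ideal (B.ClosingRing K (b - 1)))
      = (B.closing ℓ (b - 1)).nonlocalIdeal K := by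
  rw [B.map_quadraticIdeal, ← B.prod_isClosure]
  exact (B.closing ℓ (b - 1)).quadraticIdeal_colon K _ Fin.val (B.closing_ascending ℓ (b - 1))
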